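/- Let $d\ge 1$ and let $[n]=\{1,\dots,n\}$ with its natural order. A $d$-tournament on $[n]$ is a map $\epsilon:\binom{[n]}{d+1}\to\{-1,1\}$. For $\sigma=\{i_0<\dots<i_d\}$ and $\tau=\sigma\setminus\{i_j\}$ put $(\tau;\sigma)=(-1)^{d-j}$, and put $(\tau;\sigma)=0$ for a $d$-subset $\tau\not\subset\sigma$. The incidence matrix $A$ of the tournament is the real $\binom nd\times\binom n{d+1}$ matrix, with rows indexed by $d$-subsets $\tau$ and columns by $(d+1)$-subsets $\sigma$ of $[n]$, whose $(\tau,\sigma)$ entry is $\epsilon_\sigma\cdot(\tau;\sigma)$. A non-empty set $C$ of $(d+1)$-subsets is a cycle if there is a real vector $v\ge 0$ with $Av=0$ whose support is $C$; the tournament is acyclic if it has no cycle. Let $a_d(n)$ be the number of acyclic $d$-tournaments on $[n]$. 1. For every integer $d\ge1$ and every sufficiently large $n$ (depending on $d$), $$a_d(n)\le\left(\frac{e}{d+1}\,n\right)^{\binom nd}.$$ 2. For every integer $d\ge1$, with $H_d=\sum_{k=1}^d\frac1k$, there is a sequence $\eta_n\to0$ (depending on $d$) with $e^{H_d}+\eta_n>0$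 and $$a_d(n)\ge\left(\frac{n}{e^{H_d}+\eta_n}\right)^{\binom nd}\qquad\text{for all } n.$$ 3. There is a sequence $\delta_d\to0$ such that for every $d\ge1$ and every sufficiently large $n$ (depending on $d$), $$a_d(n)\ge\left(\frac{e^{-\gamma}+\delta_d}{d}\,n\right)^{\binom nd},$$ where $\gamma$ is the Euler constant. -/

import Mathlib

open Filter Topology Matrix

/-- The `k`-element subsets of `V`, i.e. the faces of dimension `k - 1`. -/
abbrev Face (V : Type*) (k : ℕ) : Type _ := {s : Finset V // s.card = k}

/-- A `d`-tournament on `V`: an orientation `ε σ ∈ {1, -1}` of every `(d+1)`-subset `σ` of `V`. -/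
structure HTournament (V : Type*) (d : ℕ) where
  ε : Face V (d + 1) → ℤˣ

/-- The sign `(τ; σ)`: if `σ = {i₀ < ⋯ < i_d}` and `τ = σ \ {i_j}` it is `(-1)^(d-j)`, and it is
`0` if `τ` is not contained in `σ` (at most one summand is nonzero). -/
def inducedSign {V : Type*} [LinearOrder V] {d : ℕ} (τ : Face V d) (σ : Face V (d + 1)) : ℤ :=
  ∑ j : Fin (d + 1), if τ.1 = σ.1.erase (σ.1.orderEmbOfFin σ.2 j) then (-1) ^ (d - (j : ℕ)) else 0

namespace HTournament

/-- The incidence matrix: rows are the `d`-subsets, columns the `(d+1)`-subsets of `V`, and the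
`(τ, σ)` entry is the orientation induced by `σ` on `τ`. -/
def incidenceMatrix {V : Type*} [LinearOrder V] {d : ℕ} (T : HTournament V d) :
    Matrix (Face V d) (Face V (d + 1)) ℝ :=
  Matrix.of fun τ σ => (((T.ε σ : ℤ) * inducedSign τ σ : ℤ) : ℝ)

/-- A nonempty set `C` of `d`-faces is a cycle if it is the support of a nonnegative real vector
in the kernel of the incidence matrix. -/
def IsCycle {V : Type*} [LinearOrder V] [Fintype V] {d : ℕ} (T : HTournament V d)
    (C : Finset (Face V (d + 1))) : Prop :=
  C.Nonempty ∧ ∃ v : Face V (d + 1) → ℝ,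
    (∀ σ, 0 ≤ v σ) ∧ T.incidenceMatrix *ᵥ v = 0 ∧ ∀ σ, 0 < v σ ↔ σ ∈ C

def IsAcyclic {V : Type*} [LinearOrder V] [Fintype V] {d : ℕ} (T : HTournament V d) : Prop :=
  ∀ C : Finset (Face V (d + 1)), ¬ T.IsCycle C

end HTournament

/-- `a_d(n)`: the number of acyclic `d`-tournaments on the vertex set `{0 < 1 < ⋯ < n-1}`. -/
noncomputable def numAcyclic (d n : ℕ) : ℕ :=
  Nat.card {T : HTournament (Fin n) d // T.IsAcyclic}

/-! Upper bound: identify a tournament with its set of positive faces. If acyclic tournaments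
realise every sign pattern on `S`, the columns indexed by `S` are independent: given a dependence
`c`, take an acyclic tournament with the signs of `c`; then `|c|` lies in the kernel of its
incidence matrix, so `c = 0`. Hence the VC dimension is at most the number of rows, `n.choose d`,
and Sauer–Shelah with the usual estimate of binomial sums gives the bound.

Lower bound: an acyclic tournament on `n` vertices and an acyclic link of one dimension less at a
new last vertex combine into an acyclic tournament, so `a_{d+1}(n+1) ≥ a_{d+1}(n) a_d(n)`. Starting
from `a_1(n) ≥ n!` (linear orders), double induction gives `a_d(n) ≥ ((n-d+1)/e^{H_d})^{n.choose
d}`. The last bound follows from `H_d - log d → γ`. -/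

section Signs

variable {V : Type*} [LinearOrder V]

lemma card_filter_orderEmbOfFin_lt {d : ℕ} (s : Finset V) (hs : s.card = d + 1) (j : Fin (d + 1)) :
    (s.filter (s.orderEmbOfFin hs j < ·)).card = d - j := by
  have h : s.filter (s.orderEmbOfFin hs j < ·) =
      (Finset.Ioi j).map (s.orderEmbOfFin hs).toEmbedding := by
    ext x
    simp only [Finset.mem_filter, Finset.mem_map, Finset.mem_Ioi, RelEmbedding.coe_toEmbedding]
    constructor
    · rintro ⟨hx, hlt⟩
      have hx' : x ∈ Set.range (s.orderEmbOfFin hs) := by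
        rw [Finset.range_orderEmbOfFin]; exact hx
      obtain ⟨i, rfl⟩ := hx'
      exact ⟨i, by simpa using hlt, rfl⟩
    · rintro ⟨i, hi, rfl⟩
      exact ⟨Finset.orderEmbOfFin_mem _ _ _, by simpa using hi⟩
  rw [h, Finset.card_map, Fin.card_Ioi]
  omega

/-- The exponent `d - j` counts the vertices above the removed one; in this form the sign can be
transported along embeddings and cones. -/
lemma inducedSign_eq_sum {d : ℕ} (τ : Face V d) (σ : Face V (d + 1)) :
    inducedSign τ σ =
      ∑ x ∈ σ.1, if τ.1 = σ.1.erase x then (-1) ^ (σ.1.filter (x < ·)).card else 0 := by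
  conv_rhs => rw [← Finset.map_orderEmbOfFin_univ σ.1 σ.2]
  rw [Finset.sum_map, Finset.map_orderEmbOfFin_univ σ.1 σ.2]
  refine Finset.sum_congr rfl fun j _ => ?_
  simp only [RelEmbedding.coe_toEmbedding, card_filter_orderEmbOfFin_lt]

end Signs

namespace HTournament

instance {V : Type*} [Finite V] (d : ℕ) : Finite (HTournament V d) :=
  Finite.of_injective HTournament.ε fun ⟨_⟩ ⟨_⟩ h => by cases h; rfl

/-! ### Acyclicity as a kernel condition -/

section Acyclic

variable {V : Type*} [LinearOrder V] [Fintype V] {d : ℕ}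

lemma incidenceMatrix_mulVec (T : HTournament V d) (v : Face V (d + 1) → ℝ) (τ : Face V d) :
    (T.incidenceMatrix *ᵥ v) τ = ∑ σ, ((T.ε σ : ℤ) : ℝ) * (inducedSign τ σ : ℝ) * v σ := by
  simp [Matrix.mulVec, dotProduct, incidenceMatrix]

lemma isAcyclic_iff (T : HTournament V d) :
    T.IsAcyclic ↔ ∀ v : Face V (d + 1) → ℝ, (∀ σ, 0 ≤ v σ) → T.incidenceMatrix *ᵥ v = 0 →
      v = 0 := by
  constructor
  · intro h v hv hA
    by_contra hne
    obtain ⟨σ, hσ⟩ := Function.ne_iff.1 hne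
    exact h (Finset.univ.filter (0 < v ·))
      ⟨⟨σ, by simpa using lt_of_le_of_ne (hv σ) (Ne.symm hσ)⟩, v, hv, hA, by simp⟩
  · rintro h C ⟨⟨σ, hσ⟩, v, hv, hA, hC⟩
    have := (hC σ).2 hσ
    simp [h v hv hA] at this

/-- The easy half of Gordan's alternative: pair a kernel vector with the certificate `y`. -/
lemma isAcyclic_of_vecMul_pos (T : HTournament V d) (y : Face V d → ℝ)
    (hy : ∀ σ, 0 < (y ᵥ* T.incidenceMatrix) σ) : T.IsAcyclic := by
  rw [isAcyclic_iff]
  intro v hv hA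
  have h : (y ᵥ* T.incidenceMatrix) ⬝ᵥ v = 0 := by
    rw [← Matrix.dotProduct_mulVec, hA, dotProduct_zero]
  rw [dotProduct, Finset.sum_eq_zero_iff_of_nonneg
    fun σ _ => mul_nonneg (hy σ).le (hv σ)] at h
  funext σ
  exact (mul_eq_zero.1 (h σ (Finset.mem_univ σ))).resolve_left (hy σ).ne'

end Acyclic

end HTournament

/-! ### Adding a last vertex: the cone recursion -/

section Cone

variable {n : ℕ}

/-- A face of `{0, …, n-1}` seen as a face of `{0, …, n}`. -/
def faceCastSucc {k : ℕ} (σ : Face (Fin n) k) : Face (Fin (n + 1)) k :=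
  ⟨σ.1.map Fin.castSuccEmb, by rw [Finset.card_map, σ.2]⟩

lemma last_notMem_map_castSuccEmb (s : Finset (Fin n)) :
    Fin.last n ∉ s.map Fin.castSuccEmb := by
  simp

lemma last_mem_cons_map_castSuccEmb (s : Finset (Fin n)) :
    Fin.last n ∈ Finset.cons (Fin.last n) (s.map Fin.castSuccEmb)
      (last_notMem_map_castSuccEmb s) :=
  Finset.mem_cons_self _ _

/-- The cone over a face of `{0, …, n-1}` with apex the last vertex `n`. -/
def faceCone {k : ℕ} (σ : Face (Fin n) k) : Face (Fin (n + 1)) (k + 1) :=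
  ⟨Finset.cons (Fin.last n) (σ.1.map Fin.castSuccEmb) (last_notMem_map_castSuccEmb _), by
    rw [Finset.card_cons, Finset.card_map, σ.2]⟩

lemma faceCastSucc_injective {k : ℕ} :
    Function.Injective (faceCastSucc : Face (Fin n) k → Face (Fin (n + 1)) k) := fun _ _ h =>
  Subtype.ext (Finset.map_injective _ (congrArg Subtype.val h))

lemma faceCone_injective {k : ℕ} :
    Function.Injective (faceCone : Face (Fin n) k → Face (Fin (n + 1)) (k + 1)) := fun σ τ h => by
  have h' := congrArg (fun s : Face (Fin (n + 1)) (k + 1) => s.1.erase (Fin.last n)) h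
  simp only [faceCone, Finset.erase_cons] at h'
  exact Subtype.ext (Finset.map_injective _ h')

lemma exists_map_castSuccEmb_eq (s : Finset (Fin (n + 1))) (hs : Fin.last n ∉ s) :
    ∃ t : Finset (Fin n), t.map Fin.castSuccEmb = s := by
  refine ⟨Finset.univ.filter fun i => i.castSucc ∈ s, ?_⟩
  ext x
  simp only [Finset.mem_map, Finset.mem_filter, Finset.mem_univ, true_and, Fin.coe_castSuccEmb]
  constructor
  · rintro ⟨i, hi, rfl⟩
    exact hi
  · intro hx
    obtain ⟨i, rfl⟩ := Fin.exists_castSucc_eq.2 (fun h : x = Fin.last n => hs (h ▸ hx))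
    exact ⟨i, hx, rfl⟩

lemma sumElim_faceCastSucc_faceCone_bijective (k : ℕ) :
    Function.Bijective (Sum.elim faceCastSucc faceCone :
      Face (Fin n) (k + 1) ⊕ Face (Fin n) k → Face (Fin (n + 1)) (k + 1)) := by
  constructor
  · refine faceCastSucc_injective.sumElim faceCone_injective fun σ τ h => ?_
    have := congrArg Subtype.val h
    refine last_notMem_map_castSuccEmb σ.1 ?_
    change Fin.last n ∈ (faceCastSucc σ).1
    rw [this]
    exact last_mem_cons_map_castSuccEmb τ.1
  · rintro ⟨s, hs⟩
    by_cases hl : Fin.last n ∈ s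
    · obtain ⟨t, ht⟩ := exists_map_castSuccEmb_eq (s.erase (Fin.last n)) (Finset.notMem_erase _ _)
      refine ⟨Sum.inr ⟨t, ?_⟩, Subtype.ext ?_⟩
      · rw [← Finset.card_map Fin.castSuccEmb, ht, Finset.card_erase_of_mem hl, hs,
          Nat.add_sub_cancel]
      · simp [faceCone, ht, Finset.insert_erase hl]
    · obtain ⟨t, ht⟩ := exists_map_castSuccEmb_eq s hl
      exact ⟨Sum.inl ⟨t, by rw [← Finset.card_map Fin.castSuccEmb, ht, hs]⟩, Subtype.ext ht⟩

/-- The faces of `{0, …, n}` are the faces of `{0, …, n-1}` and the cones over these. -/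
noncomputable def faceSumEquiv (n k : ℕ) :
    Face (Fin n) (k + 1) ⊕ Face (Fin n) k ≃ Face (Fin (n + 1)) (k + 1) :=
  Equiv.ofBijective _ (sumElim_faceCastSucc_faceCone_bijective k)

lemma inducedSign_faceCastSucc {d : ℕ} (τ : Face (Fin n) d) (σ : Face (Fin n) (d + 1)) :
    inducedSign (faceCastSucc τ) (faceCastSucc σ) = inducedSign τ σ := by
  simp only [inducedSign_eq_sum, faceCastSucc, Finset.sum_map]
  refine Finset.sum_congr rfl fun x _ => ?_
  simp only [← Finset.map_erase, Finset.map_inj, Finset.filter_map, Finset.card_map]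
  rfl

lemma inducedSign_faceCone_faceCastSucc {d : ℕ} (τ : Face (Fin n) d)
    (σ : Face (Fin n) (d + 2)) : inducedSign (faceCone τ) (faceCastSucc σ) = 0 := by
  rw [inducedSign_eq_sum]
  refine Finset.sum_eq_zero fun x _ => if_neg fun h => ?_
  have hl : Fin.last n ∈ (faceCone τ).1 := last_mem_cons_map_castSuccEmb τ.1
  rw [h] at hl
  exact last_notMem_map_castSuccEmb _ (Finset.mem_of_mem_erase hl)

/-- The apex lies above every other vertex, so each exponent grows by one. The global sign does not
affect kernels. -/
lemma inducedSign_faceCone {d : ℕ} (τ : Face (Fin n) d) (σ : Face (Fin n) (d + 1)) :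
    inducedSign (faceCone τ) (faceCone σ) = -inducedSign τ σ := by
  simp only [inducedSign_eq_sum, faceCone]
  rw [Finset.sum_cons, Finset.sum_map, if_neg, zero_add, ← Finset.sum_neg_distrib]
  · refine Finset.sum_congr rfl fun x _ => ?_
    have hne : Fin.last n ≠ x.castSucc := (Fin.castSucc_lt_last x).ne'
    have h1 : (Finset.cons (Fin.last n) (τ.1.map Fin.castSuccEmb)
        (last_notMem_map_castSuccEmb _) = (Finset.cons (Fin.last n) (σ.1.map Fin.castSuccEmb)
        (last_notMem_map_castSuccEmb _)).erase (Fin.castSuccEmb x)) ↔ τ.1 = σ.1.erase x := by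
      rw [Finset.erase_cons_of_ne _ (by simpa using hne)]
      constructor
      · intro h
        have h' := congrArg (Finset.erase · (Fin.last n)) h
        simp only [Finset.erase_cons, ← Finset.map_erase] at h'
        exact Finset.map_injective _ h'
      · intro h
        simp only [h, Finset.map_erase]
    have h2 : ((Finset.cons (Fin.last n) (σ.1.map Fin.castSuccEmb)
        (last_notMem_map_castSuccEmb _)).filter (Fin.castSuccEmb x < ·)).card =
        (σ.1.filter (x < ·)).card + 1 := by
      rw [Finset.filter_cons_of_pos _ _ _ _ (by simp),
        Finset.card_cons, Finset.filter_map, Finset.card_map]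
      congr 1
    simp only [h1, h2, pow_succ]
    split_ifs <;> simp
  · intro h
    have hl : Fin.last n ∈ (faceCone τ).1 := last_mem_cons_map_castSuccEmb τ.1
    change (faceCone τ).1 = _ at h
    rw [h] at hl
    exact Finset.notMem_erase _ _ hl

namespace HTournament

/-- The tournament on `{0, …, n}` that restricts to `T` on `{0, …, n-1}` and has link `L` at the
last vertex. -/
noncomputable def cone {d : ℕ} (T : HTournament (Fin n) (d + 1)) (L : HTournament (Fin n) d) :
    HTournament (Fin (n + 1)) (d + 1) :=
  ⟨Sum.elim T.ε L.ε ∘ (faceSumEquiv n (d + 1)).symm⟩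

lemma cone_ε_faceCastSucc {d : ℕ} (T : HTournament (Fin n) (d + 1)) (L : HTournament (Fin n) d)
    (σ : Face (Fin n) (d + 2)) : (cone T L).ε (faceCastSucc σ) = T.ε σ := by
  change Sum.elim T.ε L.ε ((faceSumEquiv n (d + 1)).symm (faceSumEquiv n (d + 1) (Sum.inl σ))) = _
  rw [Equiv.symm_apply_apply, Sum.elim_inl]

lemma cone_ε_faceCone {d : ℕ} (T : HTournament (Fin n) (d + 1)) (L : HTournament (Fin n) d)
    (σ : Face (Fin n) (d + 1)) : (cone T L).ε (faceCone σ) = L.ε σ := by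
  change Sum.elim T.ε L.ε ((faceSumEquiv n (d + 1)).symm (faceSumEquiv n (d + 1) (Sum.inr σ))) = _
  rw [Equiv.symm_apply_apply, Sum.elim_inr]

lemma cone_incidenceMatrix_mulVec {d : ℕ} (T : HTournament (Fin n) (d + 1))
    (L : HTournament (Fin n) d) (v : Face (Fin (n + 1)) (d + 2) → ℝ)
    (τ : Face (Fin (n + 1)) (d + 1)) :
    ((cone T L).incidenceMatrix *ᵥ v) τ =
      (∑ σ, ((T.ε σ : ℤ) : ℝ) * (inducedSign τ (faceCastSucc σ) : ℝ) * v (faceCastSucc σ)) +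
      ∑ σ, ((L.ε σ : ℤ) : ℝ) * (inducedSign τ (faceCone σ) : ℝ) * v (faceCone σ) := by
  rw [incidenceMatrix_mulVec, ← (faceSumEquiv n (d + 1)).sum_comp, Fintype.sum_sum_type]
  congr 1
  · refine Finset.sum_congr rfl fun σ _ => ?_
    change (((cone T L).ε (faceCastSucc σ) : ℤ) : ℝ) * (inducedSign τ (faceCastSucc σ) : ℝ) *
      v (faceCastSucc σ) = _
    rw [cone_ε_faceCastSucc]
  · refine Finset.sum_congr rfl fun σ _ => ?_
    change (((cone T L).ε (faceCone σ) : ℤ) : ℝ) * (inducedSign τ (faceCone σ) : ℝ) *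
      v (faceCone σ) = _
    rw [cone_ε_faceCone]

/-- The incidence matrix is block triangular: rows of cones meet only columns of cones, where the
block is minus that of `L`. So `v` vanishes on cones first, and what remains is a kernel vector for
`T`. -/
lemma IsAcyclic.cone {d : ℕ} {T : HTournament (Fin n) (d + 1)} {L : HTournament (Fin n) d}
    (hT : T.IsAcyclic) (hL : L.IsAcyclic) : (cone T L).IsAcyclic := by
  rw [isAcyclic_iff] at hT hL ⊢
  intro v hv hA
  have hcone : (fun σ => v (faceCone σ)) = 0 := by
    refine hL _ (fun σ => hv _) (funext fun τ => ?_)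
    have h := congrFun hA (faceCone τ)
    rw [cone_incidenceMatrix_mulVec] at h
    simp only [inducedSign_faceCone_faceCastSucc, inducedSign_faceCone] at h
    rw [incidenceMatrix_mulVec]
    simpa using h
  have hbase : (fun σ => v (faceCastSucc σ)) = 0 := by
    refine hT _ (fun σ => hv _) (funext fun τ => ?_)
    have h := congrFun hA (faceCastSucc τ)
    rw [cone_incidenceMatrix_mulVec] at h
    simp only [inducedSign_faceCastSucc, fun σ => congrFun hcone σ] at h
    rw [incidenceMatrix_mulVec]
    simpa using h
  funext σ
  obtain ⟨σ | σ, rfl⟩ := (sumElim_faceCastSucc_faceCone_bijective (n := n) (d + 1)).2 σ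
  · exact congrFun hbase σ
  · exact congrFun hcone σ

end HTournament

open HTournament in
lemma numAcyclic_mul_le (d n : ℕ) :
    numAcyclic (d + 1) n * numAcyclic d n ≤ numAcyclic (d + 1) (n + 1) := by
  unfold numAcyclic
  rw [← Nat.card_prod]
  refine Nat.card_le_card_of_injective
    (fun p => ⟨cone p.1.1 p.2.1, p.1.2.cone p.2.2⟩) ?_
  rintro ⟨⟨⟨T⟩, hT⟩, ⟨⟨L⟩, hL⟩⟩ ⟨⟨⟨T'⟩, hT'⟩, ⟨⟨L'⟩, hL'⟩⟩ h
  have h' := congrArg Subtype.val h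
  obtain rfl : T = T' := funext fun σ => by
    have := congrFun (congrArg HTournament.ε h') (faceCastSucc σ)
    simpa only [cone_ε_faceCastSucc] using this
  obtain rfl : L = L' := funext fun σ => by
    have := congrFun (congrArg HTournament.ε h') (faceCone σ)
    simpa only [cone_ε_faceCone] using this
  rfl

end Cone

/-! ### Lower bounds -/

section LowerBound

lemma one_le_numAcyclic_of_le {d n : ℕ} (h : n ≤ d) : 1 ≤ numAcyclic d n := by
  have : IsEmpty (Face (Fin n) (d + 1)) := ⟨fun σ => by
    have := σ.1.card_le_univ
    rw [σ.2, Fintype.card_fin] at this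
    omega⟩
  have : Nonempty {T : HTournament (Fin n) d // T.IsAcyclic} :=
    ⟨⟨⟨isEmptyElim⟩, (HTournament.isAcyclic_iff _).2 fun v _ _ => Subsingleton.elim _ _⟩⟩
  exact Nat.card_pos

namespace HTournament

variable {n : ℕ}

/-- The tournament in which the edge `{i < j}` is positive iff `π i < π j`. -/
noncomputable def ofPerm (π : Equiv.Perm (Fin n)) : HTournament (Fin n) 1 :=
  ⟨fun σ => if π (σ.1.orderEmbOfFin σ.2 0) < π (σ.1.orderEmbOfFin σ.2 1) then 1 else -1⟩

lemma ofPerm_isAcyclic (π : Equiv.Perm (Fin n)) : (ofPerm π).IsAcyclic := by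
  -- The rank `π` serves as a potential; the minus sign compensates `({b}; {a < b}) = -1`.
  refine isAcyclic_of_vecMul_pos _ (fun τ => -∑ x ∈ τ.1, ((π x : ℕ) : ℝ)) fun σ => ?_
  set a := σ.1.orderEmbOfFin σ.2 0 with ha
  set b := σ.1.orderEmbOfFin σ.2 1 with hb
  have hab : a < b := by simp [ha, hb]
  have hσ : σ.1 = {a, b} := by
    rw [← Finset.map_orderEmbOfFin_univ σ.1 σ.2]
    simp [Fin.univ_succ, ha, hb]
  have hea : σ.1.erase a = {b} := by
    rw [hσ, Finset.erase_insert (by simpa using hab.ne)]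
  have heb : σ.1.erase b = {a} := by
    rw [hσ, Finset.pair_comm, Finset.erase_insert (by simpa using hab.ne')]
  have hsign : ∀ τ : Face (Fin n) 1, inducedSign τ σ =
      (if τ = ⟨{b}, rfl⟩ then -1 else 0) + if τ = ⟨{a}, rfl⟩ then 1 else 0 := fun τ => by
    rw [inducedSign, Fin.sum_univ_two]
    simp only [← ha, ← hb, hea, heb, Subtype.ext_iff]
    simp
  have hval : ((fun τ : Face (Fin n) 1 => -∑ x ∈ τ.1, ((π x : ℕ) : ℝ)) ᵥ*
      (ofPerm π).incidenceMatrix) σ =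
      (((ofPerm π).ε σ : ℤ) : ℝ) * (((π b : ℕ) : ℝ) - ((π a : ℕ) : ℝ)) := by
    simp only [Matrix.vecMul, dotProduct, incidenceMatrix, Matrix.of_apply, hsign]
    push_cast
    simp only [mul_add, Finset.sum_add_distrib, mul_ite, mul_zero]
    simp
    ring
  rw [hval]
  have hne : π a ≠ π b := fun h => hab.ne (π.injective h)
  change 0 < (((if π a < π b then 1 else -1 : ℤˣ) : ℤ) : ℝ) * _
  split_ifs with h
  · simpa using h
  · have : π b < π a := lt_of_le_of_ne (not_lt.1 h) hne.symm
    simpa using this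

lemma ofPerm_injective : Function.Injective (ofPerm : Equiv.Perm (Fin n) → _) := by
  intro π ρ h
  have hlt : ∀ i j : Fin n, i < j → (π i < π j ↔ ρ i < ρ j) := fun i j hij => by
    have hc : ({i, j} : Finset (Fin n)).card = 2 := Finset.card_pair hij.ne
    have h' := congrFun (congrArg HTournament.ε h) ⟨{i, j}, hc⟩
    have hmono : StrictMono ![i, j] := by
      intro x y hxy
      fin_cases x <;> fin_cases y <;> simp_all
    have hemb := Finset.orderEmbOfFin_unique hc (f := ![i, j])
      (fun x => by fin_cases x <;> simp) hmono
    simp only [ofPerm, ← hemb] at h'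
    change (if π i < π j then (1 : ℤˣ) else -1) = if ρ i < ρ j then 1 else -1 at h'
    by_cases h1 : π i < π j <;> by_cases h2 : ρ i < ρ j
    · exact iff_of_true h1 h2
    · rw [if_pos h1, if_neg h2] at h'
      exact absurd h' (by decide)
    · rw [if_neg h1, if_pos h2] at h'
      exact absurd h' (by decide)
    · exact iff_of_false h1 h2
  have hall : ∀ i j : Fin n, π i < π j ↔ ρ i < ρ j := fun i j => by
    rcases lt_trichotomy i j with hij | rfl | hij
    · exact hlt i j hij
    · simp
    · have h1 : π i ≠ π j := fun h => hij.ne' (π.injective h)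
      have h2 : ρ i ≠ ρ j := fun h => hij.ne' (ρ.injective h)
      have := hlt j i hij
      omega
  -- Equal comparisons make `π.symm.trans ρ` an order automorphism of `Fin n`, hence the identity.
  let e : Fin n ≃o Fin n := ⟨π.symm.trans ρ, fun {a b} => by
    rw [← not_lt, ← not_lt]
    simpa using (not_congr (hall (π.symm b) (π.symm a))).symm⟩
  have he : e = OrderIso.refl _ := Subsingleton.elim _ _
  ext i
  have := congrArg (fun f : Fin n ≃o Fin n => f (π i)) he
  simp [e] at this
  rw [this]

end HTournament

lemma factorial_le_numAcyclic_one (n : ℕ) : n.factorial ≤ numAcyclic 1 n := by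
  have h := Nat.card_le_card_of_injective
    (fun π : Equiv.Perm (Fin n) =>
      (⟨HTournament.ofPerm π, HTournament.ofPerm_isAcyclic π⟩ :
        {T : HTournament (Fin n) 1 // T.IsAcyclic}))
    fun π ρ h => HTournament.ofPerm_injective (congrArg Subtype.val h)
  rwa [Nat.card_eq_fintype_card, Fintype.card_perm, Fintype.card_fin] at h

/-- `n ^ n / n!` is one term of the series of `e ^ n`. -/
lemma div_exp_one_pow_le_factorial (n : ℕ) : ((n : ℝ) / Real.exp 1) ^ n ≤ n.factorial := by
  have h := Real.pow_div_factorial_le_exp (n : ℝ) (Nat.cast_nonneg n) n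
  rw [div_pow, ← Real.exp_nat_mul, mul_one, div_le_iff₀ (Real.exp_pos _)]
  rwa [div_le_iff₀ (by positivity), mul_comm] at h

/-- The source of the new harmonic term `1 / (d + 2)`: use `1 + x ≤ e ^ x` and the ratio of
consecutive binomial coefficients. -/
lemma succ_div_pow_choose_le (d m : ℕ) :
    (((m + 2 : ℕ) : ℝ) / ((m + 1 : ℕ) : ℝ)) ^ ((m + d + 2).choose (d + 2)) ≤
      Real.exp (1 / (d + 2 : ℕ)) ^ ((m + d + 2).choose (d + 1)) := by
  have hchoose : (m + d + 2).choose (d + 2) * (d + 2) = (m + d + 2).choose (d + 1) * (m + 1) := by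
    have := Nat.choose_succ_right_eq (m + d + 2) (d + 1)
    rwa [show m + d + 2 - (d + 1) = m + 1 by omega] at this
  have hbase : ((m + 2 : ℕ) : ℝ) / ((m + 1 : ℕ) : ℝ) ≤ Real.exp (1 / ((m + 1 : ℕ) : ℝ)) := by
    have h : ((m + 2 : ℕ) : ℝ) / ((m + 1 : ℕ) : ℝ) = 1 / ((m + 1 : ℕ) : ℝ) + 1 := by
      push_cast
      field_simp
      ring
    rw [h]
    exact Real.add_one_le_exp _
  refine (pow_le_pow_left₀ (by positivity) hbase _).trans_eq ?_
  rw [← Real.exp_nat_mul, ← Real.exp_nat_mul]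
  congr 1
  have : ((m + d + 2).choose (d + 2) : ℝ) * ((d + 2 : ℕ) : ℝ) =
      ((m + d + 2).choose (d + 1) : ℝ) * ((m + 1 : ℕ) : ℝ) := by exact_mod_cast hchoose
  field_simp
  rw [this, mul_comm]

/-- Here `m + 1` is the number of vertices minus the dimension plus one; with this shift the
induction closes without error terms. Pascal's rule splits the exponent to match the two factors of
the recursion. -/
lemma pow_choose_le_numAcyclic_add (d m : ℕ) :
    (((m + 1 : ℕ) : ℝ) / Real.exp (harmonic (d + 1) : ℚ)) ^ ((m + d + 1).choose (d + 1)) ≤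
      numAcyclic (d + 1) (m + d + 1) := by
  induction d generalizing m with
  | zero =>
    have h1 := div_exp_one_pow_le_factorial (m + 1)
    have h2 : ((m + 1).factorial : ℝ) ≤ numAcyclic 1 (m + 1) := by
      exact_mod_cast factorial_le_numAcyclic_one (m + 1)
    simpa [harmonic_succ] using h1.trans h2
  | succ d ihd =>
    induction m with
    | zero =>
      have h1 : (1 : ℝ) ≤ numAcyclic (d + 2) (d + 2) := by
        exact_mod_cast one_le_numAcyclic_of_le (le_refl (d + 2))
      have h2 : (0 : ℝ) ≤ (harmonic (d + 2) : ℚ) := by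
        rw [harmonic]
        push_cast
        positivity
      have h3 : (1 : ℝ) / Real.exp (harmonic (d + 2) : ℚ) ≤ 1 := by
        rw [div_le_one (Real.exp_pos _)]
        exact Real.one_le_exp h2
      rw [show 0 + (d + 1) + 1 = d + 2 by ring, Nat.choose_self, pow_one]
      simpa using h3.trans h1
    | succ m ihm =>
      have hstep : (numAcyclic (d + 2) (m + d + 2) : ℝ) * numAcyclic (d + 1) (m + d + 2) ≤
          numAcyclic (d + 2) (m + d + 3) := by
        exact_mod_cast numAcyclic_mul_le (d + 1) (m + d + 2)
      have ih1 := ihd (m + 1)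
      rw [show m + 1 + d + 1 = m + d + 2 by ring] at ih1
      rw [show m + (d + 1) + 1 = m + d + 2 by ring] at ihm
      rw [show m + 1 + (d + 1) + 1 = m + d + 3 by ring]
      refine le_trans ?_ ((mul_le_mul ihm ih1 (by positivity) (by positivity)).trans hstep)
      have hexp : Real.exp (harmonic (d + 1 + 1) : ℚ) =
          Real.exp (harmonic (d + 1) : ℚ) * Real.exp (1 / (d + 2 : ℕ)) := by
        rw [← Real.exp_add, harmonic_succ (d + 1)]
        push_cast
        congr 2
        rw [one_div]
        norm_num [add_assoc]
      have hkey := succ_div_pow_choose_le d m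
      rw [Nat.choose_succ_succ' (m + d + 2) (d + 1), pow_add, hexp]
      set E := Real.exp (harmonic (d + 1) : ℚ)
      set F := Real.exp (1 / (d + 2 : ℕ))
      set p := (m + d + 2).choose (d + 1)
      set q := (m + d + 2).choose (d + 2)
      have hE : 0 < E := Real.exp_pos _
      have hF : 0 < F := Real.exp_pos _
      have hm : (0 : ℝ) < ((m + 1 : ℕ) : ℝ) := by positivity
      change _ ≤ (((m + 1 : ℕ) : ℝ) / (E * F)) ^ q * (((m + 2 : ℕ) : ℝ) / E) ^ p
      change (((m + 2 : ℕ) : ℝ) / (E * F)) ^ p * (((m + 2 : ℕ) : ℝ) / (E * F)) ^ q ≤ _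
      have e1 : (((m + 2 : ℕ) : ℝ) / (E * F)) ^ q =
          (((m + 1 : ℕ) : ℝ) / (E * F)) ^ q * (((m + 2 : ℕ) : ℝ) / ((m + 1 : ℕ) : ℝ)) ^ q := by
        rw [← mul_pow]
        congr 1
        field_simp
      have e2 : (((m + 2 : ℕ) : ℝ) / E) ^ p = (((m + 2 : ℕ) : ℝ) / (E * F)) ^ p * F ^ p := by
        rw [← mul_pow]
        congr 1
        field_simp
      rw [e1, e2, mul_left_comm]
      gcongr

lemma pow_choose_le_numAcyclic {d n : ℕ} (hd : 1 ≤ d) (hn : d ≤ n) :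
    (((n : ℝ) - d + 1) / Real.exp (harmonic d : ℚ)) ^ (n.choose d) ≤ numAcyclic d n := by
  obtain ⟨d, rfl⟩ := Nat.exists_eq_add_of_le' hd
  obtain ⟨m, rfl⟩ := Nat.exists_eq_add_of_le' hn
  have h := pow_choose_le_numAcyclic_add d m
  have e : ((m + (d + 1) : ℕ) : ℝ) - (d + 1 : ℕ) + 1 = (m + 1 : ℕ) := by push_cast; ring
  rw [e]
  exact h

theorem exists_tendsto_pow_choose_le_numAcyclic {d : ℕ} (hd : 1 ≤ d) :
    ∃ η : ℕ → ℝ, Tendsto η atTop (𝓝 0) ∧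
      ∀ n : ℕ, 0 < Real.exp ((harmonic d : ℚ) : ℝ) + η n ∧
        ((n : ℝ) / (Real.exp ((harmonic d : ℚ) : ℝ) + η n)) ^ (n.choose d) ≤
          (numAcyclic d n : ℝ) := by
  set E := Real.exp ((harmonic d : ℚ) : ℝ) with hE
  have hE0 : 0 < E := Real.exp_pos _
  -- Solves `n / (E + η) = (n - d + 1) / E`. For `n < d` the exponent is `0`, so any value keeping
  -- the base positive would do.
  refine ⟨fun n => if d ≤ n then E * (d - 1) / ((n : ℝ) - d + 1) else 0, ?_, fun n => ?_⟩
  · have hlim : Tendsto (fun n : ℕ => E * (d - 1) / ((n : ℝ) - d + 1)) atTop (𝓝 0) := by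
      refine Tendsto.div_atTop tendsto_const_nhds ?_
      have : Tendsto (fun n : ℕ => (n : ℝ) + (-d + 1)) atTop atTop :=
        tendsto_atTop_add_const_right _ _ tendsto_natCast_atTop_atTop
      exact this.congr fun n => by ring
    refine hlim.congr' ?_
    filter_upwards [eventually_ge_atTop d] with n hn
    rw [if_pos hn]
  · by_cases hn : d ≤ n
    · have hn' : (d : ℝ) ≤ n := by exact_mod_cast hn
      have hd' : (1 : ℝ) ≤ d := by exact_mod_cast hd
      have hpos : (0 : ℝ) < (n : ℝ) - d + 1 := by linarith
      have hn0 : (0 : ℝ) < n := by linarith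
      simp only [if_pos hn]
      have e : E + E * (d - 1) / ((n : ℝ) - d + 1) = E * n / ((n : ℝ) - d + 1) := by
        field_simp
        ring
      rw [e]
      refine ⟨by positivity, ?_⟩
      have e2 : (n : ℝ) / (E * n / ((n : ℝ) - d + 1)) = ((n : ℝ) - d + 1) / E := by
        field_simp
      rw [e2]
      exact pow_choose_le_numAcyclic hd hn
    · simp only [if_neg hn, add_zero]
      refine ⟨hE0, ?_⟩
      rw [Nat.choose_eq_zero_of_lt (not_le.1 hn), pow_zero]
      exact_mod_cast one_le_numAcyclic_of_le (not_le.1 hn).le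

lemma tendsto_mul_exp_neg_harmonic :
    Tendsto (fun d : ℕ => (d : ℝ) * Real.exp (-((harmonic d : ℚ) : ℝ))) atTop
      (𝓝 (Real.exp (-Real.eulerMascheroniConstant))) := by
  have h := (Real.continuous_exp.tendsto _).comp Real.tendsto_harmonic_sub_log.neg
  refine h.congr' ?_
  filter_upwards [eventually_ge_atTop 1] with d hd
  have hd0 : (0 : ℝ) < d := by exact_mod_cast hd
  simp only [Function.comp]
  rw [neg_sub, sub_eq_add_neg, Real.exp_add, Real.exp_log hd0]

theorem exists_tendsto_eventually_pow_choose_le_numAcyclic :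
    ∃ δ : ℕ → ℝ, Tendsto δ atTop (𝓝 0) ∧ ∀ d : ℕ, 1 ≤ d → ∀ᶠ n : ℕ in atTop,
      ((Real.exp (-Real.eulerMascheroniConstant) + δ d) / (d : ℝ) * (n : ℝ)) ^ (n.choose d) ≤
        (numAcyclic d n : ℝ) := by
  -- The factor `1 - 1 / (d + 1)` absorbs the loss from `n` to `n - d + 1` once `n ≥ d (d + 1)`, and
  -- tends to `1`.
  refine ⟨fun d => (d : ℝ) * Real.exp (-((harmonic d : ℚ) : ℝ)) * (1 - 1 / ((d : ℝ) + 1)) -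
    Real.exp (-Real.eulerMascheroniConstant), ?_, fun d hd => ?_⟩
  · have h1 : Tendsto (fun d : ℕ => 1 - 1 / ((d : ℝ) + 1)) atTop (𝓝 (1 - 0)) :=
      tendsto_const_nhds.sub tendsto_one_div_add_atTop_nhds_zero_nat
    have h2 := (tendsto_mul_exp_neg_harmonic.mul h1).sub_const
      (Real.exp (-Real.eulerMascheroniConstant))
    simpa using h2
  · have hd0 : (0 : ℝ) < d := by exact_mod_cast hd
    filter_upwards [eventually_ge_atTop (d * (d + 1))] with n hn
    have hnd : d ≤ n := le_trans (Nat.le_mul_of_pos_right d d.succ_pos) hn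
    refine le_trans (pow_le_pow_left₀ ?_ ?_ _) (pow_choose_le_numAcyclic hd hnd)
    · rw [add_sub_cancel]
      have : 1 / ((d : ℝ) + 1) ≤ 1 := by
        rw [div_le_one (by positivity)]
        linarith
      have : 0 ≤ 1 - 1 / ((d : ℝ) + 1) := by linarith
      positivity
    · have hn' : (d : ℝ) * (d + 1) ≤ n := by exact_mod_cast hn
      rw [add_sub_cancel, Real.exp_neg]
      have e : (d : ℝ) * (Real.exp ((harmonic d : ℚ) : ℝ))⁻¹ * (1 - 1 / ((d : ℝ) + 1)) / d * n =
          (n - n / ((d : ℝ) + 1)) / Real.exp ((harmonic d : ℚ) : ℝ) := by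
        field_simp
      rw [e]
      have : (d : ℝ) ≤ n / ((d : ℝ) + 1) := (le_div_iff₀ (by positivity)).2 hn'
      gcongr
      linarith

end LowerBound

/-! ### Upper bound by VC dimension -/

section UpperBound

/-- Weight the sum by `x ^ r ≤ x ^ k` with `x = r / m ≤ 1` and compare with `(1 + x) ^ m ≤ e ^ r`.
-/
lemma sum_choose_le_pow {m r : ℕ} (hr : 0 < r) (hrm : r ≤ m) :
    (∑ k ∈ Finset.range (r + 1), (m.choose k : ℝ)) ≤ (Real.exp 1 * m / r) ^ r := by
  have hr0 : (0 : ℝ) < r := by exact_mod_cast hr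
  have hm0 : (0 : ℝ) < m := by exact_mod_cast hr.trans_le hrm
  set x : ℝ := r / m with hx
  have hx0 : 0 < x := by positivity
  have hx1 : x ≤ 1 := by
    rw [hx, div_le_one hm0]
    exact_mod_cast hrm
  have h1 : (∑ k ∈ Finset.range (r + 1), (m.choose k : ℝ)) * x ^ r ≤ Real.exp 1 ^ r := by
    calc (∑ k ∈ Finset.range (r + 1), (m.choose k : ℝ)) * x ^ r
        ≤ ∑ k ∈ Finset.range (r + 1), x ^ k * 1 ^ (m - k) * (m.choose k : ℝ) := by
          rw [Finset.sum_mul]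
          refine Finset.sum_le_sum fun k hk => ?_
          rw [one_pow, mul_one, mul_comm]
          gcongr ?_ * _
          exact pow_le_pow_of_le_one hx0.le hx1 (Nat.lt_succ_iff.1 (Finset.mem_range.1 hk))
      _ ≤ ∑ k ∈ Finset.range (m + 1), x ^ k * 1 ^ (m - k) * (m.choose k : ℝ) :=
          Finset.sum_le_sum_of_subset_of_nonneg
            (Finset.range_subset_range.2 (by omega)) fun k _ _ => by positivity
      _ = (x + 1) ^ m := (add_pow x 1 m).symm
      _ ≤ Real.exp x ^ m := pow_le_pow_left₀ (by positivity) (Real.add_one_le_exp x) m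
      _ = Real.exp 1 ^ r := by
          rw [← Real.exp_nat_mul, ← Real.exp_nat_mul, hx]
          congr 1
          field_simp
  rw [← le_div_iff₀ (by positivity), ← div_pow] at h1
  refine h1.trans_eq ?_
  congr 1
  rw [hx]
  field_simp

namespace HTournament

section PositiveFaces

variable {V : Type*} [Fintype V] {d : ℕ}

/-- The set of positively oriented faces. -/
def positiveFaces (T : HTournament V d) : Finset (Face V (d + 1)) :=
  Finset.univ.filter (T.ε · = 1)

lemma mem_positiveFaces (T : HTournament V d) (σ : Face V (d + 1)) :
    σ ∈ T.positiveFaces ↔ T.ε σ = 1 := by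
  simp [positiveFaces]

lemma positiveFaces_injective :
    Function.Injective (positiveFaces : HTournament V d → Finset (Face V (d + 1))) := by
  rintro ⟨ε⟩ ⟨ε'⟩ h
  have hε : ε = ε' := funext fun σ => by
    have h' : ε σ = 1 ↔ ε' σ = 1 := by
      rw [← mem_positiveFaces ⟨ε⟩ σ, h, mem_positiveFaces]
    rcases Int.units_eq_one_or (ε σ) with h1 | h1
    · rw [h1, h'.1 h1]
    · rcases Int.units_eq_one_or (ε' σ) with h2 | h2
      · rw [h'.2 h2, h2]
      · rw [h1, h2]
  rw [hε]

end PositiveFaces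

variable {V : Type*} [LinearOrder V] [Fintype V] {d : ℕ}

open Classical in
/-- The family of sets of positive faces of acyclic tournaments. -/
noncomputable def acyclicFamily (V : Type*) [LinearOrder V] [Fintype V] (d : ℕ) :
    Finset (Finset (Face V (d + 1))) :=
  Finset.univ.filter fun s => ∃ T : HTournament V d, T.IsAcyclic ∧ T.positiveFaces = s

lemma card_acyclicFamily :
    (acyclicFamily V d).card = Nat.card {T : HTournament V d // T.IsAcyclic} := by
  rw [← Nat.card_eq_finsetCard]
  symm
  refine Nat.card_congr (Equiv.ofBijective
    (fun T => ⟨T.1.positiveFaces, by simpa [acyclicFamily] using ⟨T.1, T.2, rfl⟩⟩) ⟨?_, ?_⟩)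
  · intro T T' h
    exact Subtype.ext (positiveFaces_injective (congrArg Subtype.val h))
  · rintro ⟨s, hs⟩
    simp only [acyclicFamily, Finset.mem_filter, Finset.mem_univ, true_and] at hs
    obtain ⟨T, hT, rfl⟩ := hs
    exact ⟨⟨T, hT⟩, rfl⟩

/-- Sign patterns of a linear dependence between columns extend to no acyclic tournament. -/
lemma linearIndependent_of_shatters {S : Finset (Face V (d + 1))}
    (hS : (acyclicFamily V d).Shatters S) :
    LinearIndependent ℝ fun σ : S => fun τ : Face V d => (inducedSign τ σ.1 : ℝ) := by
  rw [Fintype.linearIndependent_iff]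
  intro c hc
  set c' : Face V (d + 1) → ℝ := fun σ => if h : σ ∈ S then c ⟨σ, h⟩ else 0 with hc'
  have hcS : ∀ σ : S, c' σ.1 = c σ := fun σ => by simp [hc']
  -- Shattering yields an acyclic tournament that is positive on `S` exactly where the dependence
  -- is, so `|c'|` is in its kernel.
  obtain ⟨u, hu, hSu⟩ := hS (Finset.filter_subset (0 < c' ·) S)
  simp only [acyclicFamily, Finset.mem_filter, Finset.mem_univ, true_and] at hu
  obtain ⟨T, hT, rfl⟩ := hu
  rw [isAcyclic_iff] at hT
  have habs : ∀ σ, ((T.ε σ : ℤ) : ℝ) * |c' σ| = c' σ := fun σ => by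
    by_cases hσ : σ ∈ S
    · have hmem : T.ε σ = 1 ↔ 0 < c' σ := by
        have := congrArg (σ ∈ ·) hSu
        simpa [hσ, mem_positiveFaces] using this
      rcases Int.units_eq_one_or (T.ε σ) with h | h
      · rw [h, abs_of_pos (hmem.1 h)]
        simp
      · have hle : c' σ ≤ 0 := not_lt.1 fun hlt => by
          rw [hmem.2 hlt] at h
          exact absurd h (by decide)
        rw [h, abs_of_nonpos hle]
        simp
    · simp [hc', hσ]
  have hzero := hT (fun σ => |c' σ|) (fun σ => abs_nonneg _) (funext fun τ => by
    rw [incidenceMatrix_mulVec]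
    have h := congrFun hc τ
    simp only [Finset.sum_apply, Pi.smul_apply, smul_eq_mul, Pi.zero_apply] at h ⊢
    rw [← h, Finset.univ_eq_attach]
    simp only [← hcS]
    rw [Finset.sum_attach S fun σ => c' σ * (inducedSign τ σ : ℝ)]
    rw [← Finset.sum_subset (Finset.subset_univ S) fun σ _ hσ => by simp [hc', hσ]]
    refine Finset.sum_congr rfl fun σ _ => ?_
    rw [mul_right_comm, habs])
  intro σ
  rw [← hcS]
  exact abs_eq_zero.1 (congrFun hzero σ.1)

lemma vcDim_acyclicFamily_le :
    (acyclicFamily V d).vcDim ≤ Fintype.card (Face V d) := by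
  refine Finset.sup_le fun S hS => ?_
  have h := (linearIndependent_of_shatters (Finset.mem_shatterer.1 hS)).fintype_card_le_finrank
  simpa using h

end HTournament

lemma card_face_fin (n k : ℕ) : Fintype.card (Face (Fin n) k) = n.choose k := by
  simp [Face]

lemma numAcyclic_le_sum_choose (d n : ℕ) :
    numAcyclic d n ≤ ∑ k ∈ Finset.range (n.choose d + 1), (n.choose (d + 1)).choose k := by
  unfold numAcyclic
  rw [← HTournament.card_acyclicFamily]
  refine (Finset.card_le_card_shatterer _).trans (Finset.card_shatterer_le_sum_vcDim.trans ?_)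
  rw [card_face_fin]
  refine Finset.sum_le_sum_of_subset fun k hk => ?_
  have := HTournament.vcDim_acyclicFamily_le (V := Fin n) (d := d)
  rw [card_face_fin] at this
  simp only [Finset.mem_Iic] at hk
  rw [Finset.mem_range]
  omega

theorem numAcyclic_le {d n : ℕ} (hn : 2 * d + 1 ≤ n) :
    (numAcyclic d n : ℝ) ≤ (Real.exp 1 / ((d : ℝ) + 1) * (n : ℝ)) ^ (n.choose d) := by
  have hr : 0 < n.choose d := Nat.choose_pos (by omega)
  have hmul : n.choose (d + 1) * (d + 1) = n.choose d * (n - d) := Nat.choose_succ_right_eq n d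
  -- The condition `2 * d + 1 ≤ n` says exactly that `d + 1 ≤ n - d`.
  have hrm : n.choose d ≤ n.choose (d + 1) := by
    refine Nat.le_of_mul_le_mul_right ?_ d.succ_pos
    rw [Nat.succ_eq_add_one, hmul]
    exact Nat.mul_le_mul_left _ (by omega)
  have h1 : (numAcyclic d n : ℝ) ≤
      ∑ k ∈ Finset.range (n.choose d + 1), ((n.choose (d + 1)).choose k : ℝ) := by
    exact_mod_cast numAcyclic_le_sum_choose d n
  refine h1.trans ((sum_choose_le_pow hr hrm).trans (pow_le_pow_left₀ (by positivity) ?_ _))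
  have hr0 : (0 : ℝ) < n.choose d := by exact_mod_cast hr
  have hle : (n.choose (d + 1) : ℝ) * ((d : ℝ) + 1) ≤ n.choose d * n := by
    have : n.choose (d + 1) * (d + 1) ≤ n.choose d * n := by
      rw [hmul]
      exact Nat.mul_le_mul_left _ (Nat.sub_le n d)
    exact_mod_cast this
  rw [div_mul_eq_mul_div, div_le_div_iff₀ hr0 (by positivity), mul_assoc, mul_assoc]
  refine mul_le_mul_of_nonneg_left ?_ (Real.exp_pos 1).le
  linarith

end UpperBound

theorem mainTheorem1 :
    -- upper bound
    (∀ d : ℕ, 1 ≤ d → ∀ᶠ n : ℕ in atTop,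
      (numAcyclic d n : ℝ) ≤ (Real.exp 1 / ((d : ℝ) + 1) * (n : ℝ)) ^ (n.choose d)) ∧
    -- lower bound, with `η n` the error term `o_n(1)`
    (∀ d : ℕ, 1 ≤ d → ∃ η : ℕ → ℝ, Tendsto η atTop (𝓝 0) ∧
      ∀ n : ℕ, 0 < Real.exp ((harmonic d : ℚ) : ℝ) + η n ∧
        ((n : ℝ) / (Real.exp ((harmonic d : ℚ) : ℝ) + η n)) ^ (n.choose d) ≤
          (numAcyclic d n : ℝ)) ∧
    -- lower bound for large `d`, with `δ d` the error term `o_d(1)`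
    (∃ δ : ℕ → ℝ, Tendsto δ atTop (𝓝 0) ∧ ∀ d : ℕ, 1 ≤ d → ∀ᶠ n : ℕ in atTop,
      ((Real.exp (-Real.eulerMascheroniConstant) + δ d) / (d : ℝ) * (n : ℝ)) ^ (n.choose d) ≤
        (numAcyclic d n : ℝ)) := by
  exact ⟨fun d _ => (eventually_ge_atTop (2 * d + 1)).mono fun _ hn => numAcyclic_le hn,
    fun _ hd => exists_tendsto_pow_choose_le_numAcyclic hd,
    exists_tendsto_eventually_pow_choose_le_numAcyclic⟩
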